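/- Let $\Gamma$ be a finite connected simple graph with vertex set $V$, $|V|=n\ge 1$. Let $\mathcal B(\Gamma)$ be the collection of nonempty subsets $S\subseteq V$ for which the induced subgraph $\Gamma|_S$ is connected, and let $$P_\Gamma=\Big\{x\in\mathbb R^{V}:\ \sum_{i\in V}x_i=3^{n},\quad \sum_{i\in S}x_i\ge 3^{|S|}\ \text{ for all } S\in\mathcal B(\Gamma),\ S\ne V\Big\}$$ be the graph-associahedron of $\Gamma$. Then $P_\Gamma$ is an indecomposable polytope: it is a convex polytope, and there are no convex polytopes $P_1,P_2$, both of positive dimension, such that $P_\Gamma$ is combinatorially equivalent to the Cartesian product $P_1\times P_2$. (Two polytopes are combinatorially equivalent if their posets of faces, ordered by inclusion, are isomorphic.) -/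

import Mathlib

namespace Polytopes

section General

variable {E : Type*} [AddCommGroup E] [Module ℝ E] [TopologicalSpace E]
variable {F : Type*} [AddCommGroup F] [Module ℝ F] [TopologicalSpace F]

/-- A convex polytope: the convex hull of finitely many points. -/
def IsPolytope (P : Set E) : Prop :=
  ∃ s : Set E, s.Finite ∧ P = convexHull ℝ s

/-- The dimension of a polytope: the dimension of the direction of its affine hull. -/
noncomputable def dim (P : Set E) : ℕ :=
  Module.finrank ℝ (vectorSpan ℝ P)

/-- The set of faces of `P`, ordered by inclusion: the empty face, and all sets of maximizers
on `P` of a linear functional (the zero functional gives `P` itself). -/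
abbrev Face (P : Set E) : Type _ :=
  {A : Set E // IsExposed ℝ P A}

/-- Combinatorial equivalence: the face posets are isomorphic. -/
def CombEquiv (P : Set E) (Q : Set F) : Prop :=
  Nonempty (Face P ≃o Face Q)

/-- A polytope is indecomposable if it is not, up to combinatorial equivalence, the Cartesian
product of two polytopes of positive dimension. -/
def IsIndecomposable (P : Set E) : Prop :=
  IsPolytope P ∧
    ¬ ∃ (k l : ℕ) (P₁ : Set (Fin k → ℝ)) (P₂ : Set (Fin l → ℝ)),
      IsPolytope P₁ ∧ IsPolytope P₂ ∧ 0 < dim P₁ ∧ 0 < dim P₂ ∧ CombEquiv P (P₁ ×ˢ P₂)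

end General

section GraphAssociahedron

variable {V : Type*}

/-- The graphical building set: the (nonempty) vertex sets that induce a connected subgraph. -/
def buildingSet (Γ : SimpleGraph V) : Set (Finset V) :=
  {S | (Γ.induce (S : Set V)).Connected}

/-- The graph-associahedron of `Γ`, as a subset of `ℝ^V`. -/
def graphAssociahedron [Fintype V] (Γ : SimpleGraph V) : Set (V → ℝ) :=
  {x | ∑ i, x i = 3 ^ Fintype.card V ∧
    ∀ S ∈ buildingSet Γ, S ≠ Finset.univ → (3 : ℝ) ^ S.card ≤ ∑ i ∈ S, x i}

end GraphAssociahedron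

end Polytopes

/-!
The argument compares which facets are disjoint.

The facets of a product `P₁ × P₂` are the sets `A × P₂` and `P₁ × B` with `A`, `B` facets of the
factors. Both kinds occur when the dimensions are positive, and a facet of the first kind always
meets one of the second kind. So the facets split into two nonempty classes such that disjoint
facets lie in the same class, and this property only depends on the face poset
(`CombEquiv.exists_facet_partition`).

In the graph-associahedron, every facet is the set `F_S` of points where the inequality of a
connected proper vertex set `S` (a *tube*) is tight (`eq_tubeFacet_of_isCoatom`), and the `F_{v}`
for single vertices are indeed facets (`isCoatom_tubeFacet_singleton`): an explicit point of `F_{v}`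
satisfies all other inequalities strictly. If `v ∉ S` is adjacent to a vertex of `S`, then `F_{v}`
and `F_S` are disjoint, because `3 + 3 ^ |S| < 3 ^ (|S| + 1)` (`disjoint_tubeFacet`). Since the
graph is connected, the facets of all vertices lie in one class, and every other facet `F_S` is
disjoint from the facet of some vertex adjacent to `S`. Hence there is only one class
(`facet_mem_iff`), and the graph-associahedron is not a product.

That it is a polytope follows from the Krein–Milman theorem: it is compact and convex, and an
extreme point is determined by the inequalities that are tight at it.
-/

namespace Polytopes

/-! ### Face lattices -/

section Faces

variable {E : Type*} [AddCommGroup E] [Module ℝ E] [TopologicalSpace E]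
variable {F : Type*} [AddCommGroup F] [Module ℝ F] [TopologicalSpace F]

/-- The empty face and the whole set are the extreme elements of the face poset. -/
instance Face.instBoundedOrder (P : Set E) : BoundedOrder (Face P) where
  top := ⟨P, IsExposed.refl P⟩
  le_top A := A.2.subset
  bot := ⟨∅, isExposed_empty⟩
  bot_le A := Set.empty_subset A.1

/-- The meet of two faces is their intersection. -/
instance Face.instSemilatticeInf (P : Set E) : SemilatticeInf (Face P) :=
  Subtype.semilatticeInf fun _ _ hA hB => hA.inter hB

lemma Face.ne_top_iff {P : Set E} {A : Face P} : A ≠ ⊤ ↔ (A : Set E) ≠ P :=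
  Subtype.coe_injective.ne_iff.symm

lemma Face.ne_bot_iff {P : Set E} {A : Face P} : A ≠ ⊥ ↔ (A : Set E).Nonempty := by
  rw [Set.nonempty_iff_ne_empty]
  exact Subtype.coe_injective.ne_iff.symm

lemma Face.disjoint_iff {P : Set E} {A B : Face P} :
    Disjoint A B ↔ Disjoint (A : Set E) (B : Set E) := by
  rw [_root_.disjoint_iff, Set.disjoint_iff_inter_eq_empty]
  exact Subtype.coe_injective.eq_iff.symm

lemma isExposed_prod_univ {P : Set E} {A : Set E} (hA : IsExposed ℝ P A) (Q : Set F) :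
    IsExposed ℝ (P ×ˢ Q) (A ×ˢ Q) := by
  rintro ⟨⟨a, q⟩, ha, hq⟩
  obtain ⟨l, rfl⟩ := hA ⟨a, ha⟩
  refine ⟨l.comp (ContinuousLinearMap.fst ℝ E F), ?_⟩
  ext ⟨x, y⟩
  constructor
  · rintro ⟨⟨hx, hm⟩, hy⟩
    exact ⟨⟨hx, hy⟩, fun z hz => hm z.1 hz.1⟩
  · rintro ⟨⟨hx, hy⟩, hm⟩
    exact ⟨⟨hx, fun z hz => hm (z, q) ⟨hz, hq⟩⟩, hy⟩

lemma isExposed_univ_prod {Q : Set F} {B : Set F} (hB : IsExposed ℝ Q B) (P : Set E) :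
    IsExposed ℝ (P ×ˢ Q) (P ×ˢ B) := by
  rintro ⟨⟨p, b⟩, hp, hb⟩
  obtain ⟨l, rfl⟩ := hB ⟨b, hb⟩
  refine ⟨l.comp (ContinuousLinearMap.snd ℝ E F), ?_⟩
  ext ⟨x, y⟩
  constructor
  · rintro ⟨hx, hy, hm⟩
    exact ⟨⟨hx, hy⟩, fun z hz => hm z.2 hz.2⟩
  · rintro ⟨⟨hx, hy⟩, hm⟩
    exact ⟨hx, hy, fun z hz => hm (p, z) ⟨hp, hz⟩⟩

/-- A functional on a product is a sum of functionals on the factors, so it is maximized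
factor by factor. -/
lemma exists_eq_prod_of_isExposed {P : Set E} {Q : Set F} {A : Set (E × F)}
    (hA : IsExposed ℝ (P ×ˢ Q) A) (hne : A.Nonempty) :
    ∃ B C, IsExposed ℝ P B ∧ IsExposed ℝ Q C ∧ A = B ×ˢ C := by
  obtain ⟨l, rfl⟩ := hA hne
  obtain ⟨⟨p, q⟩, ⟨hp, hq⟩, -⟩ := hne
  have hl (x : E) (y : F) : l (x, y) = l (x, 0) + l (0, y) := by
    rw [← map_add]; simp
  refine ⟨_, _, ContinuousLinearMap.toExposed.isExposed (l := l.comp (ContinuousLinearMap.inl ℝ E F)),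
    ContinuousLinearMap.toExposed.isExposed (l := l.comp (ContinuousLinearMap.inr ℝ E F)), ?_⟩
  ext ⟨x, y⟩
  simp only [ContinuousLinearMap.toExposed, Set.mem_prod, Set.mem_ofPred_eq,
    ContinuousLinearMap.comp_apply, ContinuousLinearMap.inl_apply, ContinuousLinearMap.inr_apply]
  constructor
  · rintro ⟨⟨hx, hy⟩, hm⟩
    refine ⟨⟨hx, fun z hz => ?_⟩, hy, fun z hz => ?_⟩
    · have := hm (z, y) ⟨hz, hy⟩
      rw [hl z, hl x] at this
      linarith
    · have := hm (x, z) ⟨hx, hz⟩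
      rw [hl x y, hl x z] at this
      linarith
  · rintro ⟨⟨hx, hm⟩, hy, hm'⟩
    refine ⟨⟨hx, hy⟩, fun z hz => ?_⟩
    rw [hl x, hl z.1 z.2]
    exact add_le_add (hm _ hz.1) (hm' _ hz.2)

/-- A polytope of positive dimension has a nonempty proper face: maximize a functional that
separates two of its points. -/
lemma exists_isExposed_nonempty_ne {k : ℕ} {P : Set (Fin k → ℝ)} (hP : IsPolytope P)
    (hdim : 0 < dim P) : ∃ A, IsExposed ℝ P A ∧ A.Nonempty ∧ A ≠ P := by
  have hnt : P.Nontrivial := by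
    rw [← Set.not_subsingleton_iff]
    intro h
    rw [dim, vectorSpan_of_subsingleton ℝ h, finrank_bot] at hdim
    exact lt_irrefl _ hdim
  obtain ⟨x, hx, y, hy, hxy⟩ := hnt
  obtain ⟨l, hl⟩ := geometric_hahn_banach_point_point hxy
  obtain ⟨s, hs, rfl⟩ := hP
  obtain ⟨z, hz, hmax⟩ := (hs.isCompact_convexHull ℝ).exists_isMaxOn ⟨x, hx⟩
    l.continuous.continuousOn
  refine ⟨_, ContinuousLinearMap.toExposed.isExposed (l := l), ⟨z, hz, hmax⟩, fun h => ?_⟩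
  rw [← h] at hx
  exact hl.not_ge (hx.2 y hy)

/-! ### Facets of a product -/

/-- A facet of `P ×ˢ Q` has the form `A ×ˢ Q` or `P ×ˢ B`, with `A` or `B` nonempty. -/
lemma Face.eq_prod_of_isCoatom {P : Set E} {Q : Set F} {G : Face (P ×ˢ Q)} (hG : IsCoatom G)
    (hne : (G : Set (E × F)).Nonempty) :
    (∃ A ⊆ P, A.Nonempty ∧ (G : Set (E × F)) = A ×ˢ Q) ∨
      ∃ B ⊆ Q, B.Nonempty ∧ (G : Set (E × F)) = P ×ˢ B := by
  obtain ⟨B, C, hB, hC, hBC⟩ := exists_eq_prod_of_isExposed G.2 hne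
  have hBC' : B.Nonempty ∧ C.Nonempty := by rwa [hBC, Set.prod_nonempty_iff] at hne
  have hle {H : Face (P ×ˢ Q)} (hGH : G ≤ H) (hH : H ≠ ⊤) : (G : Set (E × F)) = H := by
    rw [((hG.le_iff.1 hGH).resolve_left hH)]
  by_cases h : B = P
  · subst h
    exact Or.inr ⟨C, hC.subset, hBC'.2, hBC⟩
  · refine Or.inl ⟨B, hB.subset, hBC'.1, ?_⟩
    refine hle (H := ⟨B ×ˢ Q, isExposed_prod_univ hB Q⟩) ?_ ?_
    · change (G : Set (E × F)) ⊆ B ×ˢ Q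
      rw [hBC]
      exact Set.prod_mono_right hC.subset
    · rw [Face.ne_top_iff]
      intro heq
      obtain ⟨q, hq⟩ := hBC'.2
      refine h (hB.subset.antisymm fun x hx => ?_)
      have : (x, q) ∈ P ×ˢ Q := ⟨hx, hC.subset hq⟩
      rw [← heq] at this
      exact this.1

/-- The facets of a polytope that is combinatorially a product fall into two nonempty classes
such that facets from different classes always meet. Facets are the coatoms of the face poset; the
condition `G ≠ ⊥` only matters for a single point, where the empty face is a coatom. -/
theorem CombEquiv.exists_facet_partition {P : Set E} {k l : ℕ} {P₁ : Set (Fin k → ℝ)}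
    {P₂ : Set (Fin l → ℝ)} (h₁ : IsPolytope P₁) (h₂ : IsPolytope P₂) (hd₁ : 0 < dim P₁)
    (hd₂ : 0 < dim P₂) (h : CombEquiv P (P₁ ×ˢ P₂))
    (hP : ∀ A : Face P, A ≠ ⊥ → A ≠ ⊤ → ∃ G, IsCoatom G ∧ A ≤ G) :
    ∃ L : Set (Face P),
      (∃ G ∈ L, IsCoatom G ∧ G ≠ ⊥) ∧ (∃ G ∉ L, IsCoatom G ∧ G ≠ ⊥) ∧
      ∀ G H, IsCoatom G → IsCoatom H → G ≠ ⊥ → H ≠ ⊥ → Disjoint G H → (G ∈ L ↔ H ∈ L) := by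
  obtain ⟨e⟩ := h
  obtain ⟨A, hA, hAne, hAP⟩ := exists_isExposed_nonempty_ne h₁ hd₁
  obtain ⟨B, hB, hBne, hBP⟩ := exists_isExposed_nonempty_ne h₂ hd₂
  have hlift (C : Face (P₁ ×ˢ P₂)) (hC : C.1.Nonempty) (hC' : C.1 ≠ P₁ ×ˢ P₂) :
      ∃ G, IsCoatom G ∧ G ≠ ⊥ ∧ C.1 ⊆ (e G).1 := by
    rw [← Face.ne_bot_iff] at hC
    rw [← Face.ne_top_iff] at hC'
    obtain ⟨G, hG, hle⟩ := hP (e.symm C) (by simpa using hC) (by simpa using hC')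
    refine ⟨G, hG, ?_, e.symm_apply_le.1 hle⟩
    rintro rfl
    have := le_bot_iff.1 hle
    simp [hC] at this
  have hform (G : Face P) (hG : IsCoatom G) (hne : G ≠ ⊥) :=
    Face.eq_prod_of_isCoatom ((e.isCoatom_iff G).2 hG) (Face.ne_bot_iff.1 (by simpa using hne))
  have hmeet (G H : Face P) (hG : IsCoatom G) (hH : IsCoatom H) (hGne : G ≠ ⊥) (hHne : H ≠ ⊥)
      (hdis : Disjoint G H) (hGL : ∃ A, (e G).1 = A ×ˢ P₂) :
      ∃ A, (e H).1 = A ×ˢ P₂ := by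
    rcases hform H hH hHne with ⟨A, -, -, hA⟩ | ⟨B, hB, ⟨b, hb⟩, hHB⟩
    · exact ⟨A, hA⟩
    · obtain ⟨A, hGA⟩ := hGL
      obtain ⟨⟨a, b'⟩, ha⟩ := Face.ne_bot_iff.1 (show e G ≠ ⊥ by simpa using hGne)
      have haP := (e G).2.subset ha
      rw [hGA] at ha
      have := Face.disjoint_iff.1 (hdis.map_orderIso e)
      rw [hGA, hHB] at this
      exact (Set.disjoint_left.1 this (show (a, b) ∈ A ×ˢ P₂ from ⟨ha.1, hB hb⟩) ⟨haP.1, hb⟩).elim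
  -- one class consists of the facets that come from the first factor
  refine ⟨{G | ∃ A, (e G).1 = A ×ˢ P₂}, ?_, ?_, fun G H hG hH hG' hH' hd =>
    ⟨hmeet G H hG hH hG' hH' hd, hmeet H G hH hG hH' hG' hd.symm⟩⟩
  · obtain ⟨G, hG, hGne, hle⟩ := hlift ⟨A ×ˢ P₂, isExposed_prod_univ hA P₂⟩
      (hAne.prod (hBne.mono hB.subset)) (fun heq => hAP <| by
        obtain ⟨b, hb⟩ := hBne.mono hB.subset
        refine hA.subset.antisymm fun x hx => ?_
        have : (x, b) ∈ P₁ ×ˢ P₂ := ⟨hx, hb⟩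
        rw [← heq] at this
        exact this.1)
    refine ⟨G, ?_, hG, hGne⟩
    rcases hform G hG hGne with ⟨A', -, -, hA'⟩ | ⟨B', hB', -, hGB⟩
    · exact ⟨A', hA'⟩
    · -- a facet `P₁ ×ˢ B'` containing `A ×ˢ P₂` would be everything
      refine ((Face.ne_top_iff.1 ((e.isCoatom_iff G).2 hG).1) ?_).elim
      obtain ⟨a, ha⟩ := hAne
      rw [hGB] at hle ⊢
      rw [hB'.antisymm fun y hy => (hle (show (a, y) ∈ A ×ˢ P₂ from ⟨ha, hy⟩)).2]
  · obtain ⟨G, hG, hGne, hle⟩ := hlift ⟨P₁ ×ˢ B, isExposed_univ_prod hB P₁⟩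
      ((hAne.mono hA.subset).prod hBne) (fun heq => hBP <| by
        obtain ⟨a, ha⟩ := hAne.mono hA.subset
        refine hB.subset.antisymm fun y hy => ?_
        have : (a, y) ∈ P₁ ×ˢ P₂ := ⟨ha, hy⟩
        rw [← heq] at this
        exact this.2)
    refine ⟨G, ?_, hG, hGne⟩
    rintro ⟨A', hGA⟩
    refine Face.ne_top_iff.1 ((e.isCoatom_iff G).2 hG).1 ?_
    refine (e G).2.subset.antisymm ?_
    obtain ⟨b, hb⟩ := hBne
    rw [hGA] at hle ⊢
    exact Set.prod_mono_left fun x hx => (hle (show (x, b) ∈ P₁ ×ˢ B from ⟨hx, hb⟩)).1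

end Faces

section GraphAssociahedron

/-! ### The graph-associahedron is a polytope -/

variable {V : Type*} {Γ : SimpleGraph V}

lemma singleton_mem_buildingSet (v : V) : {v} ∈ buildingSet Γ := by
  change (Γ.induce (({v} : Finset V) : Set V)).Connected
  rw [Finset.coe_singleton]
  exact ⟨.of_subsingleton⟩

variable [Fintype V]

variable (Γ) in
/-- The tubes of `Γ`: the nonempty proper vertex sets that induce a connected subgraph. They index
the inequalities that define the graph-associahedron. -/
def tubes : Set (Finset V) :=
  {S | S ∈ buildingSet Γ ∧ S ≠ Finset.univ}

lemma graphAssociahedron_nonneg {x : V → ℝ} (hx : x ∈ graphAssociahedron Γ) (v : V) : 0 ≤ x v := by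
  by_cases h : ({v} : Finset V) = Finset.univ
  · have := hx.1
    rw [← h, Finset.sum_singleton] at this
    rw [this]
    positivity
  · have := hx.2 _ (singleton_mem_buildingSet v) h
    rw [Finset.sum_singleton] at this
    exact le_trans (by positivity) this

lemma convex_graphAssociahedron : Convex ℝ (graphAssociahedron Γ) := by
  have hsum (S : Finset V) (x y : V → ℝ) (a b : ℝ) :
      ∑ i ∈ S, (a • x + b • y) i = a * ∑ i ∈ S, x i + b * ∑ i ∈ S, y i := by
    simp [Finset.sum_add_distrib, Finset.mul_sum]
  intro x hx y hy a b ha hb hab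
  refine ⟨?_, fun S hS hS' => ?_⟩
  · rw [hsum, hx.1, hy.1, ← add_mul, hab, one_mul]
  · rw [hsum]
    calc (3 : ℝ) ^ S.card = a * 3 ^ S.card + b * 3 ^ S.card := by rw [← add_mul, hab, one_mul]
      _ ≤ _ := add_le_add (mul_le_mul_of_nonneg_left (hx.2 S hS hS') ha)
        (mul_le_mul_of_nonneg_left (hy.2 S hS hS') hb)

lemma isCompact_graphAssociahedron : IsCompact (graphAssociahedron Γ) := by
  refine (isCompact_Icc (a := (0 : V → ℝ)) (b := fun _ => 3 ^ Fintype.card V)).of_isClosed_subset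
    ?_ fun x hx => ⟨graphAssociahedron_nonneg hx, fun v => ?_⟩
  · have : graphAssociahedron Γ = {x | ∑ i, x i = 3 ^ Fintype.card V} ∩
        ⋂ S ∈ tubes Γ, {x | (3 : ℝ) ^ S.card ≤ ∑ i ∈ S, x i} := by
      ext x
      simp [graphAssociahedron, tubes]
    rw [this]
    exact (isClosed_eq (by fun_prop) continuous_const).inter
      (isClosed_biInter fun S _ => isClosed_le continuous_const (by fun_prop))
  · rw [← hx.1]
    exact Finset.single_le_sum (fun i _ => graphAssociahedron_nonneg hx i) (Finset.mem_univ v)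

/-- If every inequality tight at `y` is tight at `z`, the segment from `z` to `y` can be prolonged
beyond `y` inside the graph-associahedron. -/
lemma exists_add_smul_sub_mem {y z : V → ℝ} (hy : y ∈ graphAssociahedron Γ)
    (hz : z ∈ graphAssociahedron Γ)
    (h : ∀ S ∈ tubes Γ, ∑ i ∈ S, y i = 3 ^ S.card → ∑ i ∈ S, z i = 3 ^ S.card) :
    ∃ ε : ℝ, 0 < ε ∧ y + ε • (y - z) ∈ graphAssociahedron Γ := by
  have hsum (S : Finset V) (ε : ℝ) : ∑ i ∈ S, (y + ε • (y - z)) i =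
      ∑ i ∈ S, y i + ε * (∑ i ∈ S, y i - ∑ i ∈ S, z i) := by
    simp [Finset.sum_add_distrib, Finset.mul_sum, mul_sub]
  have key : ∀ᶠ ε : ℝ in nhds 0, ∀ S ∈ tubes Γ,
      (3 : ℝ) ^ S.card ≤ ∑ i ∈ S, y i + ε * (∑ i ∈ S, y i - ∑ i ∈ S, z i) := by
    refine (Set.toFinite (tubes Γ)).eventually_all.2 fun S hS => ?_
    rcases (hy.2 S hS.1 hS.2).eq_or_lt with heq | hlt
    · rw [h S hS heq.symm, ← heq]
      simp
    · have hc : Continuous fun ε : ℝ => ∑ i ∈ S, y i + ε * (∑ i ∈ S, y i - ∑ i ∈ S, z i) := by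
        fun_prop
      have := (hc.tendsto 0).eventually_const_lt (by simpa using hlt)
      exact this.mono fun _ => le_of_lt
  obtain ⟨ε, hε, hpos⟩ := ((key.filter_mono nhdsWithin_le_nhds).and
    (self_mem_nhdsWithin (s := Set.Ioi (0 : ℝ)))).exists
  refine ⟨ε, hpos, ?_, fun S hS hS' => ?_⟩
  · rw [hsum, hy.1, hz.1]
    ring
  · rw [hsum]
    exact hε S ⟨hS, hS'⟩

/-- A vertex is determined by the inequalities that are tight there, so there are finitely many
vertices, and the Krein–Milman theorem applies. -/
theorem isPolytope_graphAssociahedron : IsPolytope (graphAssociahedron Γ) := by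
  have hfin : ((graphAssociahedron Γ).extremePoints ℝ).Finite := by
    refine Set.Finite.of_injOn (t := Set.univ)
      (f := fun x : V → ℝ => {S | S ∈ tubes Γ ∧ ∑ i ∈ S, x i = 3 ^ S.card})
      (fun _ _ => Set.mem_univ _) (fun y hy z hz hyz => ?_) Set.finite_univ
    obtain ⟨ε, hε, hmem⟩ := exists_add_smul_sub_mem hy.1 hz.1
      fun S hS hS' => ((Set.ext_iff.1 hyz S).1 ⟨hS, hS'⟩).2
    refine ((mem_extremePoints.1 hy).2 z hz.1 _ hmem
      ⟨ε / (1 + ε), 1 / (1 + ε), by positivity, by positivity, by field_simp; ring, ?_⟩).1.symm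
    ext i
    simp
    field_simp
    ring
  refine ⟨_, hfin, ?_⟩
  conv_lhs => rw [← closure_convexHull_extremePoints isCompact_graphAssociahedron
    convex_graphAssociahedron]
  exact (hfin.isClosed_convexHull ℝ).closure_eq

/-! ### Facets of the graph-associahedron -/

variable (Γ) in
/-- The face of the graph-associahedron on which the inequality indexed by `S` is tight. -/
def tubeFace (S : Finset V) : Set (V → ℝ) :=
  {x ∈ graphAssociahedron Γ | ∑ i ∈ S, x i = 3 ^ S.card}

lemma isExposed_tubeFace {S : Finset V} (hS : S ∈ tubes Γ) :
    IsExposed ℝ (graphAssociahedron Γ) (tubeFace Γ S) := by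
  rintro ⟨w, hw, hwS⟩
  have hl (x : V → ℝ) : (-∑ i ∈ S, ContinuousLinearMap.proj i : (V → ℝ) →L[ℝ] ℝ) x =
      -∑ i ∈ S, x i := by
    simp
  refine ⟨-∑ i ∈ S, ContinuousLinearMap.proj i, ?_⟩
  ext x
  simp only [tubeFace, Set.mem_ofPred_eq, hl, neg_le_neg_iff]
  refine and_congr_right fun hx => ⟨fun h y hy => h.trans_le (hy.2 S hS.1 hS.2), fun h => ?_⟩
  exact ((h w hw).trans_eq hwS).antisymm (hx.2 S hS.1 hS.2)

/-- Every nonempty proper face lies in the face of some tube: otherwise averaging gives a point of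
the face where no inequality is tight, and a functional maximal there is constant. -/
lemma exists_subset_tubeFace {A : Set (V → ℝ)} (hA : IsExposed ℝ (graphAssociahedron Γ) A)
    (hne : A.Nonempty) (hA' : A ≠ graphAssociahedron Γ) : ∃ S ∈ tubes Γ, A ⊆ tubeFace Γ S := by
  classical
  by_contra! hcon
  have key (T : Finset (Finset V)) (hT : ∀ S ∈ T, S ∈ tubes Γ) :
      ∃ y ∈ A, ∀ S ∈ T, (3 : ℝ) ^ S.card < ∑ i ∈ S, y i := by
    induction T using Finset.induction_on with
    | empty => exact ⟨hne.some, hne.some_mem, by simp⟩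
    | insert S T _ ih =>
      obtain ⟨y, hy, hyT⟩ := ih fun U hU => hT U (Finset.mem_insert_of_mem hU)
      have hSt := hT S (Finset.mem_insert_self S T)
      obtain ⟨z, hz, hzS⟩ := Set.not_subset.1 (hcon S hSt)
      have hyP := hA.subset hy
      have hzP := hA.subset hz
      refine ⟨(1 / 2 : ℝ) • y + (1 / 2 : ℝ) • z,
        hA.convex convex_graphAssociahedron hy hz (by norm_num) (by norm_num) (by norm_num),
        fun U hU => ?_⟩
      have hsum : ∑ i ∈ U, ((1 / 2 : ℝ) • y + (1 / 2 : ℝ) • z) i =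
          1 / 2 * ∑ i ∈ U, y i + 1 / 2 * ∑ i ∈ U, z i := by
        simp [Finset.sum_add_distrib, Finset.mul_sum]
      rw [hsum]
      have h1 := hyP.2 U (hT U hU).1 (hT U hU).2
      have h2 := hzP.2 U (hT U hU).1 (hT U hU).2
      rcases Finset.mem_insert.1 hU with rfl | hU
      · have h3 : (3 : ℝ) ^ U.card < ∑ i ∈ U, z i := h2.lt_of_ne fun h => hzS ⟨hzP, h.symm⟩
        linarith
      · have h3 := hyT U hU
        linarith
  obtain ⟨y, hy, hyT⟩ := key (Set.toFinite (tubes Γ)).toFinset (by simp)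
  refine hA' (hA.subset.antisymm fun z hz => ?_)
  obtain ⟨ε, hε, hmem⟩ := exists_add_smul_sub_mem (hA.subset hy) hz
    fun S hS h => absurd h (hyT S (by simpa using hS)).ne'
  obtain ⟨l, rfl⟩ := hA hne
  have h1 := hy.2 _ hmem
  simp only [map_add, map_smul, map_sub, smul_eq_mul] at h1
  have h2 : l y ≤ l z := by
    by_contra! h
    have := mul_pos hε (sub_pos.2 h)
    linarith
  exact ⟨hz, fun w hw => (hy.2 w hw).trans h2⟩

/-- `(3 ^ j - 1) / j` is strictly increasing in `j`. -/
lemma mul_three_pow_sub_one_lt {j m : ℕ} (hj : 0 < j) (hjm : j < m) :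
    (m : ℝ) * (3 ^ j - 1) < j * (3 ^ m - 1) := by
  induction m, hjm using Nat.le_induction with
  | base =>
    have hj' : (1 : ℝ) ≤ j := by exact_mod_cast hj
    have : (0 : ℝ) < 3 ^ j * (2 * j - 1) := mul_pos (by positivity) (by linarith)
    push_cast
    rw [pow_succ]
    nlinarith
  | succ m hm ih =>
    have hj' : (1 : ℝ) ≤ j := by exact_mod_cast hj
    have hm' : (j : ℝ) + 1 ≤ m := by exact_mod_cast hm
    have h1 : (3 : ℝ) ^ j ≤ 3 ^ m := pow_le_pow_right₀ (by norm_num) (by lia)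
    have h2 : (1 : ℝ) ≤ 3 ^ m := one_le_pow₀ (by norm_num)
    push_cast
    rw [pow_succ]
    nlinarith

/-- The face of a singleton contains a point at which no other inequality is tight: all coordinates
but one are equal. -/
lemma exists_mem_tubeFace_singleton {v : V} (hv : {v} ∈ tubes Γ) :
    ∃ x ∈ tubeFace Γ {v}, ∀ S ∈ tubes Γ, S ≠ {v} → (3 : ℝ) ^ S.card < ∑ i ∈ S, x i := by
  classical
  obtain ⟨m, hm⟩ : ∃ m, Fintype.card V = m + 1 :=
    Nat.exists_eq_succ_of_ne_zero (Fintype.card_pos_iff.2 ⟨v⟩).ne'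
  have hm0 : 0 < m := by
    rw [Nat.pos_iff_ne_zero]
    rintro rfl
    exact hv.2 ((Finset.card_eq_iff_eq_univ _).1 (by simp [hm]))
  have hm0' : (0 : ℝ) < m := by exact_mod_cast hm0
  set c : ℝ := (3 ^ (m + 1) - 3) / m with hc
  have hmc : m * c = 3 ^ (m + 1) - 3 := by rw [hc]; field_simp
  -- partial sums of equal coordinates stay above the thresholds, by convexity of `3 ^ j`
  have hcj {j : ℕ} (hj : 0 < j) (hjm : j < m) : (3 : ℝ) ^ (j + 1) - 3 < j * c := by
    have := mul_three_pow_sub_one_lt hj hjm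
    rw [← mul_lt_mul_iff_right₀ hm0', mul_left_comm, hmc, pow_succ, pow_succ]
    linarith
  have hcj' {j : ℕ} (hj : 0 < j) (hjm : j ≤ m) : (3 : ℝ) ^ j < j * c := by
    have h1 : (3 : ℝ) ^ (j + 1) - 3 ≤ j * c := by
      rcases hjm.eq_or_lt with rfl | h
      · exact hmc.ge
      · exact (hcj hj h).le
    have h2 : (3 : ℝ) ≤ 3 ^ j := le_self_pow₀ (by norm_num) hj.ne'
    rw [pow_succ] at h1
    linarith
  set x : V → ℝ := Function.update (fun _ => c) v 3 with hx
  have hnotMem {S : Finset V} (hS : v ∉ S) : ∑ i ∈ S, x i = S.card * c := by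
    have h (i : V) (hi : i ∈ S) : x i = c := Function.update_of_ne (by rintro rfl; exact hS hi) _ _
    rw [Finset.sum_congr rfl h, Finset.sum_const, nsmul_eq_mul]
  have hmem {S : Finset V} (hS : v ∈ S) : ∑ i ∈ S, x i = 3 + (S.erase v).card * c := by
    rw [← Finset.add_sum_erase _ _ hS, hnotMem (Finset.notMem_erase v S), hx,
      Function.update_self]
  have hstrict : ∀ S ∈ tubes Γ, S ≠ {v} → (3 : ℝ) ^ S.card < ∑ i ∈ S, x i := by
    intro S hS hSv
    have hSne : S.Nonempty := by
      obtain ⟨⟨i, hi⟩⟩ := hS.1.nonempty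
      exact ⟨i, hi⟩
    have hcard : S.card < m + 1 := hm ▸ (Finset.card_lt_iff_ne_univ S).2 hS.2
    by_cases hvS : v ∈ S
    · have hE := Finset.card_erase_add_one hvS
      have hpos : 0 < (S.erase v).card := by
        rw [Finset.card_pos, Finset.nonempty_iff_ne_empty, Ne, Finset.erase_eq_empty_iff]
        rintro (h | h)
        · exact hSne.ne_empty h
        · exact hSv h
      have := hcj hpos (by lia)
      rw [hE] at this
      rw [hmem hvS]
      linarith
    · rw [hnotMem hvS]
      exact hcj' hSne.card_pos (by lia)
  refine ⟨x, ⟨⟨?_, fun S hS hS' => ?_⟩, by simp [hx]⟩, hstrict⟩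
  · rw [hmem (Finset.mem_univ v), Finset.card_erase_of_mem (Finset.mem_univ v), Finset.card_univ,
      hm, Nat.add_sub_cancel, hmc]
    ring
  · by_cases h : S = {v}
    · simp [h, hx]
    · exact (hstrict S ⟨hS, hS'⟩ h).le

lemma singleton_mem_tubes [Nontrivial V] (v : V) : {v} ∈ tubes Γ :=
  ⟨singleton_mem_buildingSet v, Finset.singleton_ne_univ v⟩

lemma tubeFace_ne [Nontrivial V] {S : Finset V} (hS : S ∈ tubes Γ) :
    tubeFace Γ S ≠ graphAssociahedron Γ := by
  obtain ⟨v, hv⟩ : ∃ v, S ≠ {v} := by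
    obtain ⟨v, w, hvw⟩ := exists_pair_ne V
    by_cases h : S = {v}
    · exact ⟨w, fun h' => hvw (Finset.singleton_injective (h.symm.trans h'))⟩
    · exact ⟨v, h⟩
  obtain ⟨x, hx, hstrict⟩ := exists_mem_tubeFace_singleton (singleton_mem_tubes (Γ := Γ) v)
  intro h
  have hx' : x ∈ tubeFace Γ S := h ▸ hx.1
  exact (hstrict S hS hv).ne' hx'.2

/-- The face of a tube, as an element of the face poset. -/
def tubeFacet {S : Finset V} (hS : S ∈ tubes Γ) : Face (graphAssociahedron Γ) :=
  ⟨tubeFace Γ S, isExposed_tubeFace hS⟩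

lemma tubeFacet_ne_top [Nontrivial V] {S : Finset V} (hS : S ∈ tubes Γ) : tubeFacet hS ≠ ⊤ :=
  Face.ne_top_iff.2 (tubeFace_ne hS)

lemma exists_le_tubeFacet {A : Face (graphAssociahedron Γ)} (hA : A ≠ ⊥) (hA' : A ≠ ⊤) :
    ∃ S, ∃ hS : S ∈ tubes Γ, A ≤ tubeFacet hS := by
  obtain ⟨S, hS, hle⟩ := exists_subset_tubeFace A.2 (Face.ne_bot_iff.1 hA) (Face.ne_top_iff.1 hA')
  exact ⟨S, hS, hle⟩

/-- A nonempty graph on one vertex has no tubes. -/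
lemma nontrivial_of_mem_tubes {S : Finset V} (hS : S ∈ tubes Γ) : Nontrivial V := by
  obtain ⟨⟨i, hi⟩⟩ := hS.1.nonempty
  obtain ⟨j, hj⟩ : ∃ j, j ∉ S := by
    by_contra! h
    exact hS.2 (Finset.eq_univ_of_forall h)
  exact ⟨i, j, fun h => hj (h ▸ hi)⟩

lemma eq_tubeFacet_of_isCoatom {G : Face (graphAssociahedron Γ)} (hG : IsCoatom G) (hG' : G ≠ ⊥) :
    ∃ S, ∃ hS : S ∈ tubes Γ, G = tubeFacet hS := by
  obtain ⟨S, hS, hle⟩ := exists_le_tubeFacet hG' hG.1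
  have := nontrivial_of_mem_tubes hS
  exact ⟨S, hS, (((hG.le_iff.1 hle).resolve_left (tubeFacet_ne_top hS))).symm⟩

lemma tubeFacet_singleton_ne_bot {v : V} (hv : {v} ∈ tubes Γ) : tubeFacet hv ≠ ⊥ :=
  Face.ne_bot_iff.2 <| (exists_mem_tubeFace_singleton hv).imp fun _ h => h.1

lemma isCoatom_tubeFacet_singleton {v : V} (hv : {v} ∈ tubes Γ) : IsCoatom (tubeFacet hv) := by
  have := nontrivial_of_mem_tubes hv
  refine ⟨tubeFacet_ne_top hv, fun A hA => ?_⟩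
  by_contra hA'
  obtain ⟨S, hS, hle⟩ := exists_le_tubeFacet (ne_bot_of_gt hA) hA'
  obtain ⟨x, hx, hstrict⟩ := exists_mem_tubeFace_singleton hv
  by_cases h : S = {v}
  · subst h
    exact hA.not_ge hle
  · exact (hstrict S hS h).ne' (hle (hA.le hx)).2

/-- There are finitely many faces of tubes, so a maximal one above a given face is a facet. -/
lemma exists_isCoatom_ge {A : Face (graphAssociahedron Γ)} (hA : A ≠ ⊥) (hA' : A ≠ ⊤) :
    ∃ G, IsCoatom G ∧ A ≤ G := by
  obtain ⟨S, hS, hle⟩ := exists_le_tubeFacet hA hA'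
  have := nontrivial_of_mem_tubes hS
  have hfin : {G | A ≤ G ∧ ∃ T, ∃ hT : T ∈ tubes Γ, G = tubeFacet hT}.Finite := by
    refine (Set.finite_range fun T : tubes Γ => tubeFacet T.2).subset ?_
    rintro _ ⟨-, T, hT, rfl⟩
    exact ⟨⟨T, hT⟩, rfl⟩
  obtain ⟨G, ⟨hAG, T, hT, rfl⟩, hmax⟩ := hfin.exists_maximal ⟨_, hle, S, hS, rfl⟩
  refine ⟨_, ⟨tubeFacet_ne_top hT, fun B hB => ?_⟩, hAG⟩
  by_contra hB'
  obtain ⟨U, hU, hBU⟩ := exists_le_tubeFacet (ne_bot_of_gt hB) hB'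
  exact (hB.trans_le hBU).not_ge
    (hmax ⟨hAG.trans (hB.le.trans hBU), U, hU, rfl⟩ (hB.le.trans hBU))

/-- If a vertex `v` is adjacent to a tube `S`, then `insert v S` is connected, and
`3 + 3 ^ |S| < 3 ^ (|S| + 1)`, so the inequalities of `v` and `S` are not tight simultaneously. -/
lemma disjoint_tubeFacet {S : Finset V} (hS : S ∈ tubes Γ) {u v : V} (hv : {v} ∈ tubes Γ)
    (hu : u ∈ S) (hvS : v ∉ S) (huv : Γ.Adj u v) : Disjoint (tubeFacet hv) (tubeFacet hS) := by
  classical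
  rw [Face.disjoint_iff, Set.disjoint_left]
  rintro x ⟨hx, hxv⟩ ⟨-, hxS⟩
  have hmem : insert v S ∈ buildingSet Γ := by
    have := SimpleGraph.induce_union_connected hS.1.preconnected
      (SimpleGraph.induce_pair_connected_of_adj huv).preconnected ⟨u, hu, by simp⟩
    have heq : (S : Set V) ∪ {u, v} = (insert v S : Finset V) := by
      ext i
      simp only [Set.mem_union, Finset.mem_coe, Set.mem_insert_iff, Set.mem_singleton_iff,
        Finset.mem_insert]
      grind
    rw [heq] at this
    exact this
  have hle : (3 : ℝ) ^ (insert v S).card ≤ ∑ i ∈ insert v S, x i := by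
    by_cases h : insert v S = Finset.univ
    · rw [h, hx.1, Finset.card_univ]
    · exact hx.2 _ hmem h
  rw [Finset.sum_insert hvS, Finset.card_insert_of_notMem hvS, hxS] at hle
  have h3 : (3 : ℝ) ≤ 3 ^ S.card :=
    le_self_pow₀ (by norm_num) (Finset.card_pos.2 ⟨u, hu⟩).ne'
  rw [Finset.sum_singleton, Finset.card_singleton] at hxv
  rw [hxv, pow_succ] at hle
  linarith

/-! ### Indecomposability -/

/-- Facets of adjacent vertices are disjoint, and so is the facet of a tube `S` from that of a
vertex adjacent to `S`; as `Γ` is connected, a set of facets that does not separate disjoint facets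
cannot separate any facets. -/
lemma facet_mem_iff (hΓ : Γ.Connected) {L : Set (Face (graphAssociahedron Γ))}
    (hL : ∀ G H, IsCoatom G → IsCoatom H → G ≠ ⊥ → H ≠ ⊥ → Disjoint G H → (G ∈ L ↔ H ∈ L))
    {G H : Face (graphAssociahedron Γ)} (hG : IsCoatom G) (hH : IsCoatom H) (hG' : G ≠ ⊥)
    (hH' : H ≠ ⊥) : G ∈ L ↔ H ∈ L := by
  have hnt : Nontrivial V := by
    obtain ⟨S, hS, -⟩ := eq_tubeFacet_of_isCoatom hG hG'
    exact nontrivial_of_mem_tubes hS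
  have hvert (u v : V) : tubeFacet (singleton_mem_tubes (Γ := Γ) u) ∈ L ↔
      tubeFacet (singleton_mem_tubes (Γ := Γ) v) ∈ L := by
    obtain ⟨p⟩ := hΓ.preconnected u v
    induction p with
    | nil => rfl
    | cons h _ ih =>
      refine Iff.trans ?_ ih
      exact hL _ _ (isCoatom_tubeFacet_singleton _) (isCoatom_tubeFacet_singleton _)
        (tubeFacet_singleton_ne_bot _) (tubeFacet_singleton_ne_bot _)
        (disjoint_tubeFacet _ _ (Finset.mem_singleton_self _)
          (by simpa using h.ne) h.symm)
  have hex (G : Face (graphAssociahedron Γ)) (hG : IsCoatom G) (hG' : G ≠ ⊥) :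
      ∃ v, G ∈ L ↔ tubeFacet (singleton_mem_tubes (Γ := Γ) v) ∈ L := by
    obtain ⟨S, hS, rfl⟩ := eq_tubeFacet_of_isCoatom hG hG'
    obtain ⟨⟨i, hi⟩⟩ := hS.1.nonempty
    obtain ⟨j, hj⟩ : ∃ j, j ∉ S := by
      by_contra! h
      exact hS.2 (Finset.eq_univ_of_forall h)
    obtain ⟨p⟩ := hΓ.preconnected i j
    obtain ⟨d, -, hd, hd'⟩ := p.exists_boundary_dart (S : Set V) hi hj
    exact ⟨d.snd, hL _ _ hG (isCoatom_tubeFacet_singleton _) hG' (tubeFacet_singleton_ne_bot _)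
      (disjoint_tubeFacet hS _ hd hd' d.adj).symm⟩
  obtain ⟨u, hu⟩ := hex G hG hG'
  obtain ⟨v, hv⟩ := hex H hH hH'
  rw [hu, hv, hvert u v]

end GraphAssociahedron

end Polytopes

theorem proposition2p2 {V : Type*} [Fintype V] (Γ : SimpleGraph V) (hΓ : Γ.Connected) :
    Polytopes.IsIndecomposable (Polytopes.graphAssociahedron Γ) := by
  refine ⟨Polytopes.isPolytope_graphAssociahedron, ?_⟩
  rintro ⟨k, l, P₁, P₂, h₁, h₂, hd₁, hd₂, h⟩
  obtain ⟨L, ⟨G, hGL, hG, hG'⟩, ⟨H, hHL, hH, hH'⟩, hL⟩ :=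
    h.exists_facet_partition h₁ h₂ hd₁ hd₂ fun _ => Polytopes.exists_isCoatom_ge
  exact hHL ((Polytopes.facet_mem_iff hΓ hL hG hH hG' hH').1 hGL)
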